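/- **Proposition.** Let $G$ be a real Lie group with semisimple Lie algebra $\mathfrak g$ (the Killing form $B(X,Y)=\operatorname{tr}(\operatorname{ad}X\circ\operatorname{ad}Y)$ is non-degenerate), for instance a noncompact semisimple Lie group. Let $\mathfrak g=\mathfrak k\oplus\mathfrak p$ be a Cartan decomposition: $B$ is negative definite on $\mathfrak k$ and positive definite on $\mathfrak p$, and $[\mathfrak k,\mathfrak k]\subset\mathfrak k$, $[\mathfrak k,\mathfrak p]\subset\mathfrak p$, $[\mathfrak p,\mathfrak p]\subset\mathfrak k$. Let $\theta$ be the linear map equal to $+1$ on $\mathfrak k$ and $-1$ on $\mathfrak p$, and let $\langle\cdot,\cdot\rangle$ be the canonical metric, i.e. the left invariant Riemannian metric on $G$ induced by the inner product $B_\theta(X,Y)=-B(X,\theta Y)$ on $\mathfrak g$, with norm $\|\cdot\|$. Let $\nabla$ be its Levi-Civita connection and $R(X,Y)Z=\nabla_X\nabla_YZ-\nabla_Y\nabla_XZ-\nabla_{[X,Y]}Z$ its curvature tensor. Then for all left invariant vector fields $U,V,W,W'\in\mathfrak k$ and $X,Y,Z,Z'\in\mathfrak p$, at every point of $G$, \begin{align*}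 \langle R(U,V)W,W'\rangle&=\tfrac14\big(\langle[U,W'],[V,W]\rangle-\langle[U,W],[V,W']\rangle\big),\\ \langle R(X,Y)Z,Z'\rangle&=\tfrac74\big(\langle[X,Z],[Y,Z']\rangle-\langle[Y,Z],[X,Z']\rangle\big),\\ \langle R(U,X)V,Y\rangle&=\tfrac14\big(-\langle[U,V],[X,Y]\rangle+\langle[X,V],[U,Y]\rangle\big),\\ \langle R(U,V)X,Y\rangle&=\tfrac34\big(\langle[U,X],[V,Y]\rangle-\langle[V,X],[U,Y]\rangle\big),\\ \langle R(U,V)W,X\rangle&=0,\\ \langle R(X,Y)Z,U\rangle&=0. \end{align*} In particular, $$\langle R(U,V)V,U\rangle=\tfrac14\|[U,V]\|^2,\qquad \langle R(X,Y)Y,X\rangle=-\tfrac74\|[X,Y]\|^2,\qquad \langle R(U,X)X,U\rangle=\tfrac14\|[U,X]\|^2.$$ -/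

import Mathlib

open Bundle VectorField
open scoped Manifold ContDiff

noncomputable section

/-- A Cartan decomposition `L = k ⊕ p` of a real Lie algebra: the Killing form is negative definite
on `k` and positive definite on `p`, and `[k, k] ⊆ k`, `[k, p] ⊆ p`, `[p, p] ⊆ k`. -/
structure CartanDecomposition (L : Type*) [LieRing L] [LieAlgebra ℝ L] where
  k : Submodule ℝ L
  p : Submodule ℝ L
  isCompl : IsCompl k p
  lie_k_k : ∀ u ∈ k, ∀ v ∈ k, ⁅u, v⁆ ∈ k
  lie_k_p : ∀ u ∈ k, ∀ x ∈ p, ⁅u, x⁆ ∈ p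
  lie_p_p : ∀ x ∈ p, ∀ y ∈ p, ⁅x, y⁆ ∈ k
  neg_k : ∀ u ∈ k, u ≠ 0 → killingForm ℝ L u u < 0
  pos_p : ∀ x ∈ p, x ≠ 0 → 0 < killingForm ℝ L x x

namespace CartanDecomposition
variable {L : Type*} [LieRing L] [LieAlgebra ℝ L] (C : CartanDecomposition L)

/-- The Cartan involution `θ`: it is `+1` on `k` and `-1` on `p`. -/
def cartanInvolution : L →ₗ[ℝ] L := LinearMap.ofIsCompl C.isCompl C.k.subtype (-C.p.subtype)

/-- The form `B_θ(x, y) = -B(x, θ y)`, where `B` is the Killing form. -/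
def innerForm : LinearMap.BilinForm ℝ L := -((killingForm ℝ L).compl₂ C.cartanInvolution)

lemma innerForm_apply (x y : L) : C.innerForm x y = -killingForm ℝ L x (C.cartanInvolution y) := rfl

lemma cartanInvolution_of_mem_k {u : L} (hu : u ∈ C.k) : C.cartanInvolution u = u :=
  LinearMap.ofIsCompl_apply_left C.isCompl ⟨u, hu⟩

lemma cartanInvolution_of_mem_p {x : L} (hx : x ∈ C.p) : C.cartanInvolution x = -x :=
  LinearMap.ofIsCompl_apply_right C.isCompl ⟨x, hx⟩

lemma exists_add (z : L) : ∃ u ∈ C.k, ∃ x ∈ C.p, u + x = z :=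
  Submodule.mem_sup.1 (C.isCompl.sup_eq_top ▸ Submodule.mem_top)

lemma killing_k_p [FiniteDimensional ℝ L] {u x : L} (hu : u ∈ C.k) (hx : x ∈ C.p) :
    killingForm ℝ L u x = 0 := by
  have hθ : C.cartanInvolution ∘ₗ C.cartanInvolution = LinearMap.id := by
    ext z
    obtain ⟨a, ha, b, hb, rfl⟩ := C.exists_add z
    simp [C.cartanInvolution_of_mem_k ha, C.cartanInvolution_of_mem_p hb]
  set f : L →ₗ[ℝ] L := (LieAlgebra.ad ℝ L u : L →ₗ[ℝ] L) ∘ₗ (LieAlgebra.ad ℝ L x : L →ₗ[ℝ] L)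
    with hf
  have hfa : ∀ z, f z = ⁅u, ⁅x, z⁆⁆ := fun z => rfl
  have h : C.cartanInvolution ∘ₗ f = -(f ∘ₗ C.cartanInvolution) := by
    ext z
    obtain ⟨a, ha, b, hb, rfl⟩ := C.exists_add z
    have h1 : ⁅x, a⁆ ∈ C.p := by
      rw [← lie_skew]; exact C.p.neg_mem (C.lie_k_p a ha x hx)
    have h2 := C.lie_p_p x hx b hb
    have h3 := C.lie_k_p u hu _ h1
    have h4 := C.lie_k_k u hu _ h2
    simp only [LinearMap.comp_apply, LinearMap.neg_apply, map_add, hfa, C.cartanInvolution_of_mem_k ha,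
      C.cartanInvolution_of_mem_p hb, C.cartanInvolution_of_mem_k h4, C.cartanInvolution_of_mem_p h3, lie_neg]
    abel
  have h5 : LinearMap.trace ℝ L f = -LinearMap.trace ℝ L f := by
    calc LinearMap.trace ℝ L f = LinearMap.trace ℝ L (C.cartanInvolution ∘ₗ C.cartanInvolution ∘ₗ f) := by
          rw [← LinearMap.comp_assoc, hθ, LinearMap.id_comp]
      _ = -LinearMap.trace ℝ L (C.cartanInvolution ∘ₗ (f ∘ₗ C.cartanInvolution)) := by
          rw [h, LinearMap.comp_neg, map_neg]
      _ = -LinearMap.trace ℝ L ((f ∘ₗ C.cartanInvolution) ∘ₗ C.cartanInvolution) := by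
          rw [LinearMap.trace_comp_comm']
      _ = _ := by rw [LinearMap.comp_assoc, hθ, LinearMap.comp_id]
  rw [killingForm_apply_apply]
  change LinearMap.trace ℝ L f = 0
  linarith

lemma innerForm_add [FiniteDimensional ℝ L] {u x v y : L} (hu : u ∈ C.k) (hx : x ∈ C.p)
    (hv : v ∈ C.k) (hy : y ∈ C.p) :
    C.innerForm (u + x) (v + y) = killingForm ℝ L x y - killingForm ℝ L u v := by
  have h1 := C.killing_k_p hu hy
  have h2 := C.killing_k_p hv hx
  rw [LieModule.traceForm_comm] at h2
  simp only [innerForm_apply, map_add, LinearMap.add_apply, C.cartanInvolution_of_mem_k hv, C.cartanInvolution_of_mem_p hy,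
    map_neg, h1, h2]
  ring

lemma innerForm_symm [FiniteDimensional ℝ L] (x y : L) : C.innerForm x y = C.innerForm y x := by
  obtain ⟨u, hu, a, ha, rfl⟩ := C.exists_add x
  obtain ⟨v, hv, b, hb, rfl⟩ := C.exists_add y
  rw [C.innerForm_add hu ha hv hb, C.innerForm_add hv hb hu ha,
    LieModule.traceForm_comm ℝ L L a, LieModule.traceForm_comm ℝ L L u]

lemma innerForm_pos [FiniteDimensional ℝ L] (x : L) (hx : x ≠ 0) : 0 < C.innerForm x x := by
  obtain ⟨u, hu, a, ha, rfl⟩ := C.exists_add x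
  rw [C.innerForm_add hu ha hu ha]
  by_cases h : u = 0
  · subst h
    simpa using C.pos_p a ha (by simpa using hx)
  · have h1 := C.neg_k u hu h
    by_cases h' : a = 0
    · subst h'; simpa using h1
    · linarith [C.pos_p a ha h']

end CartanDecomposition

lemma isVonNBounded_of_pos {E : Type*} [NormedAddCommGroup E] [NormedSpace ℝ E]
    [FiniteDimensional ℝ E] (B : E →L[ℝ] E →L[ℝ] ℝ) (pos : ∀ v, v ≠ 0 → 0 < B v v) :
    Bornology.IsVonNBounded ℝ {v : E | B v v < 1} := by
  have hc : Continuous fun v : E => B v v := by fun_prop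
  have : ProperSpace E := FiniteDimensional.proper ℝ E
  obtain ⟨c, hc0, hcB⟩ : ∃ c > 0, ∀ v ∈ Metric.sphere (0 : E) 1, c ≤ B v v := by
    rcases (Metric.sphere (0 : E) 1).eq_empty_or_nonempty with h | h
    · exact ⟨1, one_pos, by simp [h]⟩
    · obtain ⟨v, hv, hmin⟩ := (isCompact_sphere (0 : E) 1).exists_isMinOn h hc.continuousOn
      exact ⟨B v v, pos v (by rintro rfl; simp at hv), fun w hw => hmin hw⟩
  rw [NormedSpace.isVonNBounded_iff, isBounded_iff_forall_norm_le]
  refine ⟨c⁻¹ + 1, fun v hv => ?_⟩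
  rcases eq_or_ne v 0 with rfl | h0
  · simp; positivity
  have hn : 0 < ‖v‖ := norm_pos_iff.2 h0
  have h1 := hcB (‖v‖⁻¹ • v) (by simp [norm_smul, hn.ne'])
  have h2 : B (‖v‖⁻¹ • v) (‖v‖⁻¹ • v) = B v v / ‖v‖ ^ 2 := by
    simp; field_simp
  rw [h2, le_div_iff₀ (by positivity)] at h1
  have hv' : B v v < 1 := hv
  by_contra! hlt
  have h3 : c * (c⁻¹ + 1) = 1 + c := by field_simp
  nlinarith [mul_lt_mul_of_pos_left hlt hc0]

section
variable {E : Type*} [NormedAddCommGroup E] [NormedSpace ℝ E]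
  {H : Type*} [TopologicalSpace H] {I : ModelWithCorners ℝ E H}

instance lieGroup_minSmoothness_three {G : Type*} [TopologicalSpace G] [ChartedSpace H G] [Group G] [LieGroup I ∞ G] :
    LieGroup I (minSmoothness ℝ 3) G := by
  rw [minSmoothness_of_isRCLikeNormedField]; infer_instance

section
variable {M : Type*} [TopologicalSpace M] [ChartedSpace H M] [IsManifold I ∞ M] 

/-- `cov` is the Levi-Civita connection of the Riemannian metric `g`: it is compatible with `g`,
i.e. `X g(Y, Z) = g(∇_X Y, Z) + g(Y, ∇_X Z)`, and torsion free. In Mathlib's convention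
`cov Y x (X x)` is the value of `∇_X Y` at `x`. -/
structure IsLeviCivita [FiniteDimensional ℝ E] [CompleteSpace E]
    (g : ContMDiffRiemannianMetric I ∞ E (TangentSpace I : M → Type _))
    (cov : CovariantDerivative I E (TangentSpace I : M → Type _)) : Prop where
  metric : ∀ (X Y Z : Π x : M, TangentSpace I x) (x : M),
    MDiffAt (T% Y) x → MDiffAt (T% Z) x →
      (d% (fun y => g.inner y (Y y) (Z y)) x) (X x) =
        g.inner x (cov Y x (X x)) (Z x) + g.inner x (Y x) (cov Z x (X x))
  torsion : cov.torsion = 0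

/-- The curvature `R(X, Y) Z = ∇_X ∇_Y Z - ∇_Y ∇_X Z - ∇_[X, Y] Z`. -/
def curvature
    (cov : CovariantDerivative I E (TangentSpace I : M → Type _))
    (X Y Z : Π x : M, TangentSpace I x) : Π x : M, TangentSpace I x := fun x =>
  cov (fun y => cov Z y (Y y)) x (X x) - cov (fun y => cov Z y (X y)) x (Y x) -
    cov Z x (mlieBracket I X Y x)
end

variable {G : Type*} [TopologicalSpace G] [ChartedSpace H G] [Group G] 

/-- The derivative at `h` of left translation by `h⁻¹`, from `T_h G` to the Lie algebra. -/
def maurerCartan (h : G) : TangentSpace I h →L[ℝ] GroupLieAlgebra I G :=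
  letI A : E →L[ℝ] E := mfderiv I I (fun x : G => h⁻¹ * x) h
  A

lemma maurerCartan_injective [LieGroup I ∞ G] (h : G) :
    Function.Injective (maurerCartan (I := I) h) := by
  have hd : ∀ (a x : G), MDifferentiableAt I I (fun y : G => a * y) x := fun a x =>
    (contMDiff_mul_left (I := I) (n := ∞) (a := a)).mdifferentiableAt (by simp)
  have h1 : mfderiv I I ((fun x : G => h * x) ∘ (fun x : G => h⁻¹ * x)) h =
      ContinuousLinearMap.id ℝ _ := by
    have : (fun x : G => h * x) ∘ (fun x : G => h⁻¹ * x) = id := by ext; simp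
    rw [this]; exact mfderiv_id
  rw [mfderiv_comp (I' := I) h (hd _ _) (hd _ _)] at h1
  intro v w hvw
  have h2 : ∀ v : TangentSpace I h, mfderiv I I (fun x : G => h * x) (h⁻¹ * h)
      (mfderiv I I (fun x : G => h⁻¹ * x) h v) = v := fun v => congrArg (fun f => f v) h1
  rw [← h2 v, ← h2 w]
  exact congrArg _ hvw

lemma maurerCartan_mulInvariantVectorField [LieGroup I ∞ G] (h : G) (v : GroupLieAlgebra I G) :
    maurerCartan (I := I) h (mulInvariantVectorField v h) = v := by
  have hd : ∀ (a x : G), MDifferentiableAt I I (fun y : G => a * y) x := fun a x =>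
    (contMDiff_mul_left (I := I) (n := ∞) (a := a)).mdifferentiableAt (by simp)
  have h1 : mfderiv I I ((fun x : G => h⁻¹ * x) ∘ (fun x : G => h * x)) 1 =
      ContinuousLinearMap.id ℝ _ := by
    have : (fun x : G => h⁻¹ * x) ∘ (fun x : G => h * x) = id := by ext; simp
    rw [this]; exact mfderiv_id
  rw [mfderiv_comp (I' := I) 1 (hd _ _) (hd _ _)] at h1
  have h2 : mfderiv I I (fun x : G => h⁻¹ * x) (h * 1) (mulInvariantVectorField v h) = v :=
    congrArg (fun f => f v) h1
  rw [mul_one] at h2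
  exact h2

variable [FiniteDimensional ℝ E]

/-- The left invariant extension of a bilinear form on the Lie algebra:
`(v, w) ↦ b (d(L_{h⁻¹}) v) (d(L_{h⁻¹}) w)` on `T_h G`. -/
def leftInvariantInner (b : LinearMap.BilinForm ℝ (GroupLieAlgebra I G)) (h : G) :
   TangentSpace I h →L[ℝ] TangentSpace I h →L[ℝ] ℝ :=
   letI B : E →L[ℝ] E →L[ℝ] ℝ := LinearMap.toContinuousBilinearMap (𝕜 := ℝ) (E := E) (F := E) (G := ℝ) b
   letI A : E →L[ℝ] E := maurerCartan (I := I) h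
   letI r : E →L[ℝ] E →L[ℝ] ℝ := B.bilinearComp A A
   r

lemma leftInvariantInner_apply (b : LinearMap.BilinForm ℝ (GroupLieAlgebra I G)) (h : G)
   (v w : TangentSpace I h) :  leftInvariantInner b h v w = b (maurerCartan h v) (maurerCartan h w) := rfl

/-- On left invariant vector fields, `leftInvariantInner b` is the constant `b`. -/
lemma leftInvariantInner_mulInvariantVectorField [LieGroup I ∞ G]
    (b : LinearMap.BilinForm ℝ (GroupLieAlgebra I G)) (h : G) (v w : GroupLieAlgebra I G) :
    leftInvariantInner b h (mulInvariantVectorField v h) (mulInvariantVectorField w h) = b v w := by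
  rw [leftInvariantInner_apply, maurerCartan_mulInvariantVectorField,
    maurerCartan_mulInvariantVectorField]

lemma isVonNBounded_leftInvariantInner [LieGroup I ∞ G] (b : LinearMap.BilinForm ℝ (GroupLieAlgebra I G))
   (pos : ∀ v, v ≠ 0 → 0 < b v v) (h : G) :
   Bornology.IsVonNBounded ℝ {v : TangentSpace I h | leftInvariantInner b h v v < 1} := by
  let B : E →L[ℝ] E →L[ℝ] ℝ := leftInvariantInner b h
  exact isVonNBounded_of_pos B fun v hv => pos _ fun h0 => hv
    (maurerCartan_injective (I := I) h (h0.trans (map_zero (maurerCartan (I := I) h)).symm))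

lemma contMDiff_leftInvariantInner [LieGroup I ∞ G] (b : LinearMap.BilinForm ℝ (GroupLieAlgebra I G)) :
   ContMDiff I (I.prod 𝓘(ℝ, E →L[ℝ] E →L[ℝ] ℝ)) ∞
    (fun h : G ↦ TotalSpace.mk' (E →L[ℝ] E →L[ℝ] ℝ)
      (E := fun h : G => TangentSpace I h →L[ℝ] TangentSpace I h →L[ℝ] ℝ) h (leftInvariantInner b h)) := by
  intro x₀
  let D : G → E →L[ℝ] E := fun x => mfderiv I I (fun y : G => x⁻¹ * y) x
  let A : G → E →L[ℝ] E := inTangentCoordinates I I id (fun _ : G => (1 : G)) D x₀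
  have h1 : ContMDiffAt I 𝓘(ℝ, E →L[ℝ] E) ∞ A x₀ := by
    have h := ContMDiffAt.mfderiv (I := I) (I' := I) (J := I) (n := ∞) (m := ∞) (x₀ := x₀)
      (fun x y : G => x⁻¹ * y) id
      (((contMDiff_fst.inv).mul contMDiff_snd).contMDiffAt) contMDiffAt_id (by simp)
    have e : (fun x : G => x⁻¹ * id x) = fun _ => 1 := by ext; simp
    rw [e] at h
    exact h
  rw [contMDiffAt_hom_bundle]
  refine ⟨contMDiffAt_id, ?_⟩
  let B : E →L[ℝ] E →L[ℝ] ℝ :=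
    LinearMap.toContinuousBilinearMap (𝕜 := ℝ) (E := E) (F := E) (G := ℝ) b
  have h2 : ContMDiffAt I 𝓘(ℝ, E →L[ℝ] E →L[ℝ] ℝ) ∞
      (fun x => B.bilinearComp (A x) (A x)) x₀ := by
    have hflip : ContDiff ℝ ∞ (ContinuousLinearMap.flipₗᵢ ℝ E E ℝ) :=
      LinearIsometryEquiv.contDiff _
    have h3 := (hflip.contMDiff.contMDiffAt.comp x₀
      ((contMDiffAt_const (c := B)).clm_comp h1)).clm_comp h1
    exact hflip.contMDiff.contMDiffAt.comp x₀ h3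
  refine h2.congr_of_eventuallyEq ?_
  have hx : (chartAt H x₀).source ∈ nhds x₀ :=
    (chartAt H x₀).open_source.mem_nhds (mem_chart_source H x₀)
  filter_upwards [hx] with x hx
  ext v w
  have hx' : x ∈ (trivializationAt E (TangentSpace I : G → Type _) x₀).baseSet := hx
  have key : ∀ v : E, A x v = maurerCartan (I := I) x
        ((trivializationAt E (TangentSpace I : G → Type _) x₀).symm x v) := by
    intro v
    have e2 : A x v = D x ((tangentBundleCore I G).coordChange (achart H x₀) (achart H x) x v) := by
      simp only [A]
      rw [inTangentCoordinates_eq (I := I) (I' := I) id (fun _ => (1 : G)) D hx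
        (mem_chart_source H (1 : G))]
      exact (tangentBundleCore I G).coordChange_self (achart H (1 : G)) 1
        (mem_achart_source H (1 : G)) _
    have e3 := congrArg (fun f : E →L[ℝ] E => D x (f v))
      (TangentBundle.symmL_trivializationAt_eq_core (I := I) hx).symm
    have e4 : D x ((trivializationAt E (TangentSpace I : G → Type _) x₀).symmL ℝ x v) =
        D x ((trivializationAt E (TangentSpace I : G → Type _) x₀).symm x v) :=
      congrArg (D x) (Bundle.Trivialization.symmL_apply (R := ℝ) _ hx' v)
    exact (e2.trans e3).trans e4
  erw [inCoordinates_apply_eq₂ hx' hx' (Set.mem_univ _)]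
  simp only [Bundle.Trivial.fiberBundle_trivializationAt', Bundle.Trivial.linearMapAt_trivialization,
    LinearMap.id_coe, id_eq, leftInvariantInner_apply, ContinuousLinearMap.bilinearComp_apply, key]
  rfl

/-- The left invariant Riemannian metric induced by an inner product on the Lie algebra. -/
def leftInvariantMetric [LieGroup I ∞ G] (b : LinearMap.BilinForm ℝ (GroupLieAlgebra I G))
   (symm : ∀ v w, b v w = b w v) (pos : ∀ v, v ≠ 0 → 0 < b v v) :
   ContMDiffRiemannianMetric I ∞ E (TangentSpace I : G → Type _) where
  inner h := leftInvariantInner b h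
  symm _ _ _ := symm _ _
  pos h _ hv := pos _ (fun h0 => hv (maurerCartan_injective h (h0.trans (map_zero _).symm)))
  isVonNBounded h := isVonNBounded_leftInvariantInner b pos h
  contMDiff := contMDiff_leftInvariantInner b

variable [CompleteSpace E] [LieGroup I ∞ G]

instance finiteDimensional_groupLieAlgebra : FiniteDimensional ℝ (GroupLieAlgebra I G) := inferInstanceAs (FiniteDimensional ℝ E)

/-- The canonical metric: the left invariant Riemannian metric induced by `B_θ`. -/
def canonicalMetric (C : CartanDecomposition (GroupLieAlgebra I G)) :
    ContMDiffRiemannianMetric I ∞ E (TangentSpace I : G → Type _) :=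
  leftInvariantMetric C.innerForm C.innerForm_symm C.innerForm_pos

end

end

/-! ### Connections on a Lie algebra with an inner product. -/

section Koszul

variable {L : Type*} [LieRing L] [LieAlgebra ℝ L] {b : LinearMap.BilinForm ℝ L}

/-! Left invariance turns the problem into algebra on the Lie algebra. The metric is constant on
left invariant fields, so compatibility says that each `∇_x` is skew there. Together with vanishing
torsion this forces the Koszul formula, which determines `∇_x y`.

For `B_θ` the adjoint of `ad x` is `-ad (θ x)`, because `θ` is an involutive automorphism and the
Killing form is invariant. The Koszul formula then solves to `∇_x y = ½([x, y] + [θ y, x] + [θ x,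
y])`. So `∇_x y` is a multiple of `[x, y]` on each pair of summands: `1/2` on `(k, k)` and `(p, p)`,
`3/2` on `(k, p)`, `-1/2` on `(p, k)`.

The curvature is then a combination of double brackets; the Jacobi identity removes `[[x, y], z]`.
Since `ad u` is skew for `u ∈ k` and symmetric for `x ∈ p`, one bracket moves to the other side of
the inner product, which gives the stated formulas. The two vanishing statements come from `k ⊥ p`.
-/

lemma eq_of_forall_bilinForm_eq (pos : ∀ v, v ≠ 0 → 0 < b v v) {v w : L}
    (h : ∀ z, b v z = b w z) : v = w := by
  by_contra hne
  have h1 := pos (v - w) (sub_ne_zero.2 hne)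
  rw [LinearMap.BilinForm.sub_left, h, sub_self] at h1
  exact lt_irrefl _ h1

/-- The Koszul formula for a metric and torsion free product on a Lie algebra. -/
lemma koszul_formula (symm : ∀ v w, b v w = b w v) {D : L → L → L}
    (metric : ∀ x y z, b (D x y) z + b y (D x z) = 0)
    (torsion : ∀ x y, D x y - D y x = ⁅x, y⁆) (x y z : L) :
    2 * b (D x y) z = b ⁅x, y⁆ z - b ⁅y, z⁆ x + b ⁅z, x⁆ y := by
  simp only [← torsion, map_sub, LinearMap.sub_apply]
  -- With brackets expanded by torsion, skewness of `D y` and `D z` cancels two pairs of terms, and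
  -- skewness of `D x` makes the remaining two equal.
  linarith [metric x y z, metric y z x, metric z x y, symm y (D x z), symm z (D y x),
    symm x (D z y)]

end Koszul

/-! ### Algebra of the Cartan decomposition: adjoints, connection and curvature. -/

namespace CartanDecomposition

variable {L : Type*} [LieRing L] [LieAlgebra ℝ L] (C : CartanDecomposition L)

lemma lie_p_k {x u : L} (hx : x ∈ C.p) (hu : u ∈ C.k) : ⁅x, u⁆ ∈ C.p := by
  rw [← lie_skew]
  exact C.p.neg_mem (C.lie_k_p u hu x hx)

/-- The three bracket inclusions form a `ℤ/2`-grading, and `θ` is its sign map. -/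
lemma cartanInvolution_lie (x y : L) :
    C.cartanInvolution ⁅x, y⁆ = ⁅C.cartanInvolution x, C.cartanInvolution y⁆ := by
  obtain ⟨u, hu, a, ha, rfl⟩ := C.exists_add x
  obtain ⟨v, hv, c, hc, rfl⟩ := C.exists_add y
  simp only [add_lie, lie_add, map_add, C.cartanInvolution_of_mem_k hu,
    C.cartanInvolution_of_mem_p ha, C.cartanInvolution_of_mem_k hv,
    C.cartanInvolution_of_mem_p hc, C.cartanInvolution_of_mem_k (C.lie_k_k u hu v hv),
    C.cartanInvolution_of_mem_k (C.lie_p_p a ha c hc),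
    C.cartanInvolution_of_mem_p (C.lie_k_p u hu c hc),
    C.cartanInvolution_of_mem_p (C.lie_p_k ha hv), neg_lie, lie_neg]
  abel

/-- The adjoint of `ad x` for `B_θ` is `-ad (θ x)`. -/
lemma innerForm_lie_left (x y z : L) :
    C.innerForm ⁅x, y⁆ z = -C.innerForm y ⁅C.cartanInvolution x, z⁆ := by
  have hθ (w : L) : C.cartanInvolution (C.cartanInvolution w) = w := by
    obtain ⟨u, hu, a, ha, rfl⟩ := C.exists_add w
    simp [C.cartanInvolution_of_mem_k hu, C.cartanInvolution_of_mem_p ha]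
  -- Since `θ [θ x, z] = [x, θ z]`, only invariance of the Killing form remains.
  rw [innerForm_apply, innerForm_apply, C.cartanInvolution_lie, hθ, ← lie_skew, map_neg,
    LinearMap.neg_apply, LieModule.traceForm_apply_lie_apply]

lemma innerForm_lie_left_of_mem_k {u : L} (hu : u ∈ C.k) (y z : L) :
    C.innerForm ⁅u, y⁆ z = -C.innerForm y ⁅u, z⁆ := by
  rw [C.innerForm_lie_left, C.cartanInvolution_of_mem_k hu]

lemma innerForm_lie_left_of_mem_p {x : L} (hx : x ∈ C.p) (y z : L) :
    C.innerForm ⁅x, y⁆ z = C.innerForm y ⁅x, z⁆ := by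
  rw [C.innerForm_lie_left, C.cartanInvolution_of_mem_p hx, neg_lie, map_neg, neg_neg]

lemma innerForm_k_p [FiniteDimensional ℝ L] {u x : L} (hu : u ∈ C.k) (hx : x ∈ C.p) :
    C.innerForm u x = 0 := by
  simpa using C.innerForm_add hu C.p.zero_mem C.k.zero_mem hx

/-- The product on the Lie algebra that describes the Levi-Civita connection of the canonical
metric on left invariant vector fields. -/
noncomputable def leviCivitaProduct (x y : L) : L :=
  (1 / 2 : ℝ) • (⁅x, y⁆ + ⁅C.cartanInvolution y, x⁆ + ⁅C.cartanInvolution x, y⁆)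

/-- Taking adjoints frees `z` from the brackets in the Koszul formula; positivity then cancels it.
-/
lemma eq_leviCivitaProduct [FiniteDimensional ℝ L] {x y d : L}
    (h : ∀ z, 2 * C.innerForm d z =
      C.innerForm ⁅x, y⁆ z - C.innerForm ⁅y, z⁆ x + C.innerForm ⁅z, x⁆ y) :
    d = C.leviCivitaProduct x y := by
  refine eq_of_forall_bilinForm_eq C.innerForm_pos fun z => ?_
  have h1 := h z
  rw [C.innerForm_lie_left y z x, ← lie_skew z x, map_neg, LinearMap.neg_apply,
    C.innerForm_lie_left x z y, C.innerForm_symm z, C.innerForm_symm z] at h1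
  simp only [leviCivitaProduct, map_smul, map_add, LinearMap.smul_apply, LinearMap.add_apply,
    smul_eq_mul]
  linarith

lemma leviCivitaProduct_k_k {u v : L} (hu : u ∈ C.k) (hv : v ∈ C.k) :
    C.leviCivitaProduct u v = (1 / 2 : ℝ) • ⁅u, v⁆ := by
  rw [leviCivitaProduct, C.cartanInvolution_of_mem_k hu, C.cartanInvolution_of_mem_k hv,
    ← lie_skew v u]
  module

lemma leviCivitaProduct_p_p {x y : L} (hx : x ∈ C.p) (hy : y ∈ C.p) :
    C.leviCivitaProduct x y = (1 / 2 : ℝ) • ⁅x, y⁆ := by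
  rw [leviCivitaProduct, C.cartanInvolution_of_mem_p hx, C.cartanInvolution_of_mem_p hy,
    neg_lie, neg_lie, ← lie_skew y x]
  module

lemma leviCivitaProduct_k_p {u x : L} (hu : u ∈ C.k) (hx : x ∈ C.p) :
    C.leviCivitaProduct u x = (3 / 2 : ℝ) • ⁅u, x⁆ := by
  rw [leviCivitaProduct, C.cartanInvolution_of_mem_k hu, C.cartanInvolution_of_mem_p hx,
    neg_lie, ← lie_skew x u]
  module

lemma leviCivitaProduct_p_k {x u : L} (hx : x ∈ C.p) (hu : u ∈ C.k) :
    C.leviCivitaProduct x u = -(1 / 2 : ℝ) • ⁅x, u⁆ := by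
  rw [leviCivitaProduct, C.cartanInvolution_of_mem_k hu, C.cartanInvolution_of_mem_p hx,
    neg_lie, ← lie_skew u x]
  module

/-- The curvature of the canonical metric on left invariant vector fields. -/
noncomputable def algebraicCurvature (x y z : L) : L :=
  C.leviCivitaProduct x (C.leviCivitaProduct y z) -
    C.leviCivitaProduct y (C.leviCivitaProduct x z) - C.leviCivitaProduct ⁅x, y⁆ z

/-- In this and the next four cases each coefficient is a product of two connection weights,
corrected by the weight of `∇_[x, y]` once Jacobi splits `[[x, y], z]`. Here `1/4 - 1/2 = -1/4`. -/
lemma algebraicCurvature_k_k_k {u v w : L} (hu : u ∈ C.k) (hv : v ∈ C.k) (hw : w ∈ C.k) :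
    C.algebraicCurvature u v w = (1 / 4 : ℝ) • (⁅v, ⁅u, w⁆⁆ - ⁅u, ⁅v, w⁆⁆) := by
  rw [algebraicCurvature, C.leviCivitaProduct_k_k hv hw, C.leviCivitaProduct_k_k hu hw,
    C.leviCivitaProduct_k_k hu (C.k.smul_mem _ (C.lie_k_k v hv w hw)),
    C.leviCivitaProduct_k_k hv (C.k.smul_mem _ (C.lie_k_k u hu w hw)),
    C.leviCivitaProduct_k_k (C.lie_k_k u hu v hv) hw, lie_smul, lie_smul, lie_lie]
  module

lemma algebraicCurvature_p_p_p {x y z : L} (hx : x ∈ C.p) (hy : y ∈ C.p) (hz : z ∈ C.p) :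
    C.algebraicCurvature x y z = (7 / 4 : ℝ) • (⁅y, ⁅x, z⁆⁆ - ⁅x, ⁅y, z⁆⁆) := by
  rw [algebraicCurvature, C.leviCivitaProduct_p_p hy hz, C.leviCivitaProduct_p_p hx hz,
    C.leviCivitaProduct_p_k hx (C.k.smul_mem _ (C.lie_p_p y hy z hz)),
    C.leviCivitaProduct_p_k hy (C.k.smul_mem _ (C.lie_p_p x hx z hz)),
    -- As `[x, y] ∈ k` acts on `z ∈ p` with weight `3/2`, the coefficient of `[x, [y, z]]` is `-1/4
    -- - 3/2 = -7/4`.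
    C.leviCivitaProduct_k_p (C.lie_p_p x hx y hy) hz, lie_smul, lie_smul, lie_lie]
  module

lemma algebraicCurvature_k_p_k {u x v : L} (hu : u ∈ C.k) (hx : x ∈ C.p) (hv : v ∈ C.k) :
    C.algebraicCurvature u x v = -(1 / 4 : ℝ) • (⁅u, ⁅x, v⁆⁆ + ⁅x, ⁅u, v⁆⁆) := by
  rw [algebraicCurvature, C.leviCivitaProduct_p_k hx hv, C.leviCivitaProduct_k_k hu hv,
    C.leviCivitaProduct_k_p hu (C.p.smul_mem _ (C.lie_p_k hx hv)),
    C.leviCivitaProduct_p_k hx (C.k.smul_mem _ (C.lie_k_k u hu v hv)),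
    C.leviCivitaProduct_p_k (C.lie_k_p u hu x hx) hv, lie_smul, lie_smul, lie_lie]
  module

lemma algebraicCurvature_k_k_p {u v x : L} (hu : u ∈ C.k) (hv : v ∈ C.k) (hx : x ∈ C.p) :
    C.algebraicCurvature u v x = (3 / 4 : ℝ) • (⁅u, ⁅v, x⁆⁆ - ⁅v, ⁅u, x⁆⁆) := by
  rw [algebraicCurvature, C.leviCivitaProduct_k_p hv hx, C.leviCivitaProduct_k_p hu hx,
    C.leviCivitaProduct_k_p hu (C.p.smul_mem _ (C.lie_k_p v hv x hx)),
    C.leviCivitaProduct_k_p hv (C.p.smul_mem _ (C.lie_k_p u hu x hx)),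
    C.leviCivitaProduct_k_p (C.lie_k_k u hu v hv) hx, lie_smul, lie_smul, lie_lie]
  module

/-- Serves `⟨R(U, X)X, U⟩`, which is thus obtained without the antisymmetry of `R` in its last two
arguments. -/
lemma algebraicCurvature_k_p_p {u x y : L} (hu : u ∈ C.k) (hx : x ∈ C.p) (hy : y ∈ C.p) :
    C.algebraicCurvature u x y =
      -(1 / 4 : ℝ) • ⁅u, ⁅x, y⁆⁆ - (1 / 4 : ℝ) • ⁅x, ⁅u, y⁆⁆ := by
  rw [algebraicCurvature, C.leviCivitaProduct_p_p hx hy, C.leviCivitaProduct_k_p hu hy,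
    C.leviCivitaProduct_k_k hu (C.k.smul_mem _ (C.lie_p_p x hx y hy)),
    C.leviCivitaProduct_p_p hx (C.p.smul_mem _ (C.lie_k_p u hu y hy)),
    C.leviCivitaProduct_p_p (C.lie_k_p u hu x hx) hy, lie_smul, lie_smul, lie_lie]
  module

end CartanDecomposition

/-! ### From left invariant fields on the group to the Lie algebra. -/

section LeftInvariant

variable {E : Type*} [NormedAddCommGroup E] [NormedSpace ℝ E] {H : Type*} [TopologicalSpace H] {I : ModelWithCorners ℝ E H}
  {G : Type*} [TopologicalSpace G] [ChartedSpace H G] [Group G]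

lemma mulInvariantVectorField_sub (x y : GroupLieAlgebra I G) (h : G) :
    mulInvariantVectorField (x - y) h =
      mulInvariantVectorField x h - mulInvariantVectorField y h :=
  (mfderiv I I (fun g : G => h * g) 1).map_sub x y

variable [LieGroup I ∞ G]

lemma mlieBracket_mulInvariantVectorField [CompleteSpace E] (x y : GroupLieAlgebra I G) (h : G) :
    mlieBracket I (mulInvariantVectorField x) (mulInvariantVectorField y) h =
      mulInvariantVectorField ⁅x, y⁆ h :=
  (congrFun (mulInvariantVector_mlieBracket x y) h).symm

lemma eq_mulInvariantVectorField_of_maurerCartan_eq {h : G} {v : TangentSpace I h}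
    {x : GroupLieAlgebra I G} (hv : maurerCartan h v = x) : v = mulInvariantVectorField x h :=
  maurerCartan_injective h (hv.trans (maurerCartan_mulInvariantVectorField h x).symm)

variable [FiniteDimensional ℝ E] [CompleteSpace E]

/-- The Koszul formula for the Levi-Civita connection of a left invariant metric, on left invariant
vector fields. -/
lemma IsLeviCivita.koszul_formula {b : LinearMap.BilinForm ℝ (GroupLieAlgebra I G)}
    {symm : ∀ v w, b v w = b w v} {pos : ∀ v, v ≠ 0 → 0 < b v v}
    {cov : CovariantDerivative I E (TangentSpace I : G → Type _)}
    (hcov : IsLeviCivita (leftInvariantMetric b symm pos) cov) (h : G)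
    (x y z : GroupLieAlgebra I G) :
    2 * b (maurerCartan h (cov (mulInvariantVectorField y) h (mulInvariantVectorField x h))) z =
      b ⁅x, y⁆ z - b ⁅y, z⁆ x + b ⁅z, x⁆ y := by
  refine _root_.koszul_formula symm (D := fun x y =>
    maurerCartan h (cov (mulInvariantVectorField y) h (mulInvariantVectorField x h))) ?_ ?_ x y z
  · intro x y z
    have hm := hcov.metric (mulInvariantVectorField x) (mulInvariantVectorField y)
      (mulInvariantVectorField z) h (mdifferentiableAt_mulInvariantVectorField y)
      (mdifferentiableAt_mulInvariantVectorField z)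
    have hc : (fun g : G => (leftInvariantMetric b symm pos).inner g
        (mulInvariantVectorField y g) (mulInvariantVectorField z g)) = fun _ => b y z :=
      funext fun g => leftInvariantInner_mulInvariantVectorField b g y z
    rw [hc] at hm
    -- The inner product of two left invariant fields is constant, so the left side of metric
    -- compatibility vanishes.
    have hd : (d% (fun _ : G => b y z) h) (mulInvariantVectorField x h) = 0 := by
      simp [mvfderiv]
    rw [hd] at hm
    have e1 := leftInvariantInner_apply b h
      (cov (mulInvariantVectorField y) h (mulInvariantVectorField x h))
      (mulInvariantVectorField z h)
    have e2 := leftInvariantInner_apply b h (mulInvariantVectorField y h)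
      (cov (mulInvariantVectorField z) h (mulInvariantVectorField x h))
    rw [maurerCartan_mulInvariantVectorField] at e1 e2
    exact (congrArg₂ (· + ·) e1 e2).symm.trans hm.symm
  · intro x y
    have ht := (CovariantDerivative.torsion_eq_zero_iff cov).1 hcov.torsion
      (mdifferentiableAt_mulInvariantVectorField x (g := h))
      (mdifferentiableAt_mulInvariantVectorField y)
    rw [mlieBracket_mulInvariantVectorField] at ht
    have ht' := congrArg (maurerCartan (I := I) h) ht
    rw [maurerCartan_mulInvariantVectorField, map_sub] at ht'
    exact ht'

variable {C : CartanDecomposition (GroupLieAlgebra I G)}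
  {cov : CovariantDerivative I E (TangentSpace I : G → Type _)}

/-- The right side of the Koszul formula does not depend on the point, so the covariant derivative
is again left invariant. -/
lemma IsLeviCivita.cov_mulInvariantVectorField (hcov : IsLeviCivita (canonicalMetric C) cov)
    (h : G) (x y : GroupLieAlgebra I G) :
    cov (mulInvariantVectorField y) h (mulInvariantVectorField x h) =
      mulInvariantVectorField (C.leviCivitaProduct x y) h :=
  eq_mulInvariantVectorField_of_maurerCartan_eq
    (C.eq_leviCivitaProduct fun z => hcov.koszul_formula h x y z)

lemma IsLeviCivita.curvature_mulInvariantVectorField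
    (hcov : IsLeviCivita (canonicalMetric C) cov) (h : G) (x y z : GroupLieAlgebra I G) :
    curvature cov (mulInvariantVectorField x) (mulInvariantVectorField y)
      (mulInvariantVectorField z) h = mulInvariantVectorField (C.algebraicCurvature x y z) h := by
  -- An equality of fields on all of `G` is needed, since the result is differentiated again.
  have hfield (x y : GroupLieAlgebra I G) :
      (fun g : G => cov (mulInvariantVectorField y) g (mulInvariantVectorField x g)) =
        mulInvariantVectorField (C.leviCivitaProduct x y) :=
    funext fun g => hcov.cov_mulInvariantVectorField g x y
  rw [curvature, hfield, hfield, mlieBracket_mulInvariantVectorField,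
    hcov.cov_mulInvariantVectorField, hcov.cov_mulInvariantVectorField,
    hcov.cov_mulInvariantVectorField]
  rw [CartanDecomposition.algebraicCurvature, mulInvariantVectorField_sub,
    mulInvariantVectorField_sub]

end LeftInvariant

/-! ### The curvature formulas. -/

theorem mainTheorem7
    {E : Type*} [NormedAddCommGroup E] [NormedSpace ℝ E] [FiniteDimensional ℝ E] [CompleteSpace E]
    {H : Type*} [TopologicalSpace H] {I : ModelWithCorners ℝ E H}
    {G : Type*} [TopologicalSpace G] [ChartedSpace H G] [Group G] [LieGroup I ∞ G]
    (_hss : (killingForm ℝ (GroupLieAlgebra I G)).Nondegenerate)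
    (C : CartanDecomposition (GroupLieAlgebra I G))
    (cov : CovariantDerivative I E (TangentSpace I : G → Type _))
    (_hcov : IsLeviCivita (canonicalMetric C) cov) (h : G) :
    -- the left invariant vector field determined by an element of the Lie algebra
    let L : GroupLieAlgebra I G → Π x : G, TangentSpace I x := fun a => mulInvariantVectorField a
    -- `ip a b = ⟨a, b⟩` and `R a b c d = ⟨R(a, b)c, d⟩`, for left invariant fields, at `h`
    let ip : GroupLieAlgebra I G → GroupLieAlgebra I G → ℝ := fun a b =>
      (canonicalMetric C).inner h (L a h) (L b h)
    let R : GroupLieAlgebra I G → GroupLieAlgebra I G → GroupLieAlgebra I G →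
        GroupLieAlgebra I G → ℝ := fun a b c d =>
      (canonicalMetric C).inner h (curvature cov (L a) (L b) (L c) h) (L d h)
    (∀ U ∈ C.k, ∀ V ∈ C.k, ∀ W ∈ C.k, ∀ W' ∈ C.k,
      R U V W W' = 1 / 4 * (ip ⁅U, W'⁆ ⁅V, W⁆ - ip ⁅U, W⁆ ⁅V, W'⁆)) ∧
    (∀ X ∈ C.p, ∀ Y ∈ C.p, ∀ Z ∈ C.p, ∀ Z' ∈ C.p,
      R X Y Z Z' = 7 / 4 * (ip ⁅X, Z⁆ ⁅Y, Z'⁆ - ip ⁅Y, Z⁆ ⁅X, Z'⁆)) ∧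
    (∀ U ∈ C.k, ∀ V ∈ C.k, ∀ X ∈ C.p, ∀ Y ∈ C.p,
      R U X V Y = 1 / 4 * (-ip ⁅U, V⁆ ⁅X, Y⁆ + ip ⁅X, V⁆ ⁅U, Y⁆)) ∧
    (∀ U ∈ C.k, ∀ V ∈ C.k, ∀ X ∈ C.p, ∀ Y ∈ C.p,
      R U V X Y = 3 / 4 * (ip ⁅U, X⁆ ⁅V, Y⁆ - ip ⁅V, X⁆ ⁅U, Y⁆)) ∧
    (∀ U ∈ C.k, ∀ V ∈ C.k, ∀ W ∈ C.k, ∀ X ∈ C.p, R U V W X = 0) ∧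
    (∀ X ∈ C.p, ∀ Y ∈ C.p, ∀ Z ∈ C.p, ∀ U ∈ C.k, R X Y Z U = 0) ∧
    (∀ U ∈ C.k, ∀ V ∈ C.k, R U V V U = 1 / 4 * ip ⁅U, V⁆ ⁅U, V⁆) ∧
    (∀ X ∈ C.p, ∀ Y ∈ C.p, R X Y Y X = -(7 / 4) * ip ⁅X, Y⁆ ⁅X, Y⁆) ∧
    (∀ U ∈ C.k, ∀ X ∈ C.p, R U X X U = 1 / 4 * ip ⁅U, X⁆ ⁅U, X⁆) := by 
  intro L ip R
  have hip (a b : GroupLieAlgebra I G) : ip a b = C.innerForm a b :=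
    leftInvariantInner_mulInvariantVectorField C.innerForm h a b
  have hR (a b c d : GroupLieAlgebra I G) :
      R a b c d = C.innerForm (C.algebraicCurvature a b c) d := by
    simp only [R, L, _hcov.curvature_mulInvariantVectorField]
    exact hip _ d
  simp only [hip, hR]
  -- The last argument is left free: only brackets with `U` and `V` are moved, so the same identity
  -- also serves the vanishing case with last argument in `p`.
  have hkkk : ∀ U ∈ C.k, ∀ V ∈ C.k, ∀ W ∈ C.k, ∀ Z : GroupLieAlgebra I G,
      C.innerForm (C.algebraicCurvature U V W) Z =
        1 / 4 * (C.innerForm ⁅U, Z⁆ ⁅V, W⁆ - C.innerForm ⁅U, W⁆ ⁅V, Z⁆) := by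
    intro U hU V hV W hW Z
    rw [C.algebraicCurvature_k_k_k hU hV hW, C.innerForm_symm ⁅U, Z⁆]
    simp only [map_smul, map_sub, LinearMap.smul_apply, LinearMap.sub_apply, smul_eq_mul,
      C.innerForm_lie_left_of_mem_k hV ⁅U, W⁆, C.innerForm_lie_left_of_mem_k hU ⁅V, W⁆]
    ring
  have hppp : ∀ X ∈ C.p, ∀ Y ∈ C.p, ∀ Z ∈ C.p, ∀ Z' : GroupLieAlgebra I G,
      C.innerForm (C.algebraicCurvature X Y Z) Z' =
        7 / 4 * (C.innerForm ⁅X, Z⁆ ⁅Y, Z'⁆ - C.innerForm ⁅Y, Z⁆ ⁅X, Z'⁆) := by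
    intro X hX Y hY Z hZ Z'
    rw [C.algebraicCurvature_p_p_p hX hY hZ]
    simp only [map_smul, map_sub, LinearMap.smul_apply, LinearMap.sub_apply, smul_eq_mul,
      C.innerForm_lie_left_of_mem_p hX ⁅Y, Z⁆, C.innerForm_lie_left_of_mem_p hY ⁅X, Z⁆]
  refine ⟨fun U hU V hV W hW W' _ => hkkk U hU V hV W hW W',
    fun X hX Y hY Z hZ Z' _ => hppp X hX Y hY Z hZ Z', ?_, ?_, ?_, ?_, ?_, ?_, ?_⟩
  · intro U hU V hV X hX Y _
    rw [C.algebraicCurvature_k_p_k hU hX hV]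
    simp only [map_smul, map_add, LinearMap.smul_apply, LinearMap.add_apply, smul_eq_mul,
      C.innerForm_lie_left_of_mem_k hU ⁅X, V⁆, C.innerForm_lie_left_of_mem_p hX ⁅U, V⁆]
    ring
  · intro U hU V hV X hX Y _
    rw [C.algebraicCurvature_k_k_p hU hV hX]
    simp only [map_smul, map_sub, LinearMap.smul_apply, LinearMap.sub_apply, smul_eq_mul,
      C.innerForm_lie_left_of_mem_k hU ⁅V, X⁆, C.innerForm_lie_left_of_mem_k hV ⁅U, X⁆]
    ring
  · intro U hU V hV W hW X hX
    rw [hkkk U hU V hV W hW, C.innerForm_symm ⁅U, X⁆,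
      C.innerForm_k_p (C.lie_k_k V hV W hW) (C.lie_k_p U hU X hX),
      C.innerForm_k_p (C.lie_k_k U hU W hW) (C.lie_k_p V hV X hX)]
    ring
  · intro X hX Y hY Z hZ U hU
    rw [hppp X hX Y hY Z hZ, C.innerForm_k_p (C.lie_p_p X hX Z hZ) (C.lie_p_k hY hU),
      C.innerForm_k_p (C.lie_p_p Y hY Z hZ) (C.lie_p_k hX hU)]
    ring
  · intro U hU V hV
    rw [hkkk U hU V hV V hV, ← lie_skew V U]
    simp only [lie_self, map_zero, map_neg]
    ring
  · intro X hX Y hY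
    rw [hppp X hX Y hY Y hY, ← lie_skew Y X]
    simp only [lie_self, map_zero, map_neg]
    ring
  · intro U hU X hX
    -- Only `-¼[X, [U, X]]` survives; moving the symmetric `ad X` gives `-¼⟨[U, X], [X, U]⟩`, hence
    -- the positive sign.
    rw [C.algebraicCurvature_k_p_p hU hX hX, lie_self, lie_zero, smul_zero, zero_sub, map_neg,
      map_smul, LinearMap.neg_apply, LinearMap.smul_apply, smul_eq_mul,
      C.innerForm_lie_left_of_mem_p hX, ← lie_skew X U, map_neg]
    ring
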